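/- Let $T$ be a complete dependent (NIP) first-order theory, i.e. no formula $\varphi(\bar x,\bar y)$ is such that for every $n<\omega$ $T\vdash\exists\bar y_0\cdots\exists\bar y_{n-1}\bigwedge_{\eta\in\{0,1\}^n}\exists\bar x\bigwedge_{k<n}\varphi(\bar x,\bar y_k)^{\eta(k)}$, where $\varphi^1=\varphi$ and $\varphi^0=\neg\varphi$. Let $\mathscr C$ be a monster model of $T$; only its $\kappa$-saturation, for some cardinal $\kappa$, is used. Let $\bar{\mathbf a}^1=\langle \bar a^1_t:t\in I^1\rangle$ and $\bar{\mathbf a}^2=\langle \bar a^2_t:t\in I^2\rangle$ be two indiscernible sequences of finite tuples in $\mathscr C$ (of a fixed length in each sequence), indexed by non-empty linear orders $I^1,I^2$ without last element, with $|I^1|,|I^2|<\kappa$. For $A\subseteq\mathscr C$, $\mathrm{Av}(A,\bar{\mathbf a}^\ell)$ is the set of formulas $\varphi(\bar x,\bar c)$ with parameters $\bar c$ from $A$ such that $\mathscr C\models\varphi[\bar a^\ell_t,\bar c]$ for every large enough $t\in I^\ell$. Two sequences are mutually indiscernible over $A$ if each is indiscernible over the union of $A$ and the other one. In unions, a sequence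 or a tuple stands for the set of its elements. The sequences $\bar{\mathbf a}^1,\bar{\mathbf a}^2$ are perpendicular if for every $A\subseteq\mathscr C$ with $|A|<\kappa$ there are $\langle\bar b^\ell_n:\ell\in\{1,2\},n<\omega\rangle$ in $\mathscr C$ such that each $\bar b^\ell_n$ realizes $\mathrm{Av}(A\cup\bar{\mathbf a}^1\cup\bar{\mathbf a}^2\cup\{\bar b^k_m: m<n\text{ or }(m=n\text{ and }k<\ell)\},\bar{\mathbf a}^\ell)$ and $\langle\bar b^1_n:n<\omega\rangle,\langle\bar b^2_n:n<\omega\rangle$ are mutually indiscernible over $A\cup\bar{\mathbf a}^1\cup\bar{\mathbf a}^2$. Then the following are equivalent: 1. $\bar{\mathbf a}^1,\bar{\mathbf a}^2$ are perpendicular. 2. For every $\langle\bar b^\ell_n:\ell\in\{1,2\},n<\omega\rangle$ in $\mathscr C$ such that each $\bar b^\ell_n$ realizes $\mathrm{Av}(\bar{\mathbf a}^1\cup\bar{\mathbf a}^2\cup\{\bar b^k_m: m<n\text{ or }(m=n\text{ and }k<\ell)\},\bar{\mathbf a}^\ell)$, the sequences $\langle\bar b^1_n:n<\omega\rangle$ and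 $\langle\bar b^2_n:n<\omega\rangle$ are mutually indiscernible (over $\emptyset$). 3. For every $A\subseteq\mathscr C$ with $|A|<\kappa$: if $\bar b^1$ realizes $\mathrm{Av}(\bar{\mathbf a}^1\cup\bar{\mathbf a}^2\cup A,\bar{\mathbf a}^1)$ and $\bar b^2$ realizes $\mathrm{Av}(\bar{\mathbf a}^1\cup\bar{\mathbf a}^2\cup A\cup\bar b^1,\bar{\mathbf a}^2)$, then $\bar b^1$ realizes $\mathrm{Av}(\bar{\mathbf a}^1\cup\bar{\mathbf a}^2\cup A\cup\bar b^2,\bar{\mathbf a}^1)$. 4. For every formula $\varphi(\bar x,\bar y)$ with parameters from $\mathscr C$ there is a truth value $\mathbf t$ such that for every large enough $t\in I^1$, for every large enough $s\in I^2$, $\mathscr C\models\varphi[\bar a^1_t,\bar a^2_s]^{\mathbf t}$, and for every large enough $s\in I^2$, for every large enough $t\in I^1$, $\mathscr C\models\varphi[\bar a^1_t,\bar a^2_s]^{\mathbf t}$. 5. For some $(|I^1|+|I^2|)^+$-saturated elementary submodel $\mathscr F$ of $\mathscr C$ containing $\bar{\mathbf a}^1,\bar{\mathbf a}^2$, for every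 formula $\varphi(\bar x,\bar y)$ with parameters from $\mathscr F$ there is a truth value $\mathbf t$ such that for every large enough $t\in I^1$, for every large enough $s\in I^2$, $\mathscr C\models\varphi[\bar a^1_t,\bar a^2_s]^{\mathbf t}$, and for every large enough $s\in I^2$, for every large enough $t\in I^1$, $\mathscr C\models\varphi[\bar a^1_t,\bar a^2_s]^{\mathbf t}$. -/

import Mathlib

universe u v w

open FirstOrder Cardinal

namespace Dependent

/-- A formula `φ(x̄, c̄)` in the variables `x̄` (indexed by `α`), with a finite tuple `c̄` of
parameters from the structure `M`. -/
structure ParamFormula (L : FirstOrder.Language.{u, v}) (M : Type w) (α : Type) where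
  /-- the length of the tuple of parameters -/
  arity : ℕ
  /-- the underlying parameter-free formula `φ(x̄, z̄)` -/
  formula : L.Formula (α ⊕ Fin arity)
  /-- the parameters `c̄` -/
  params : Fin arity → M

section

variable {L : FirstOrder.Language.{u, v}} {M : Type w}

/-- `M ⊨ φ[x̄, c̄]`. -/
def ParamFormula.Holds [L.Structure M] {α : Type} (φ : ParamFormula L M α) (x : α → M) : Prop :=
  φ.formula.Realize (Sum.elim x φ.params)

/-- All the parameters of the formula lie in `A`. -/
def ParamFormula.IsOver {α : Type} (φ : ParamFormula L M α) (A : Set M) : Prop :=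
  ∀ i, φ.params i ∈ A

/-- The tuple `x` realizes the set `p` of formulas with parameters. -/
def Realizes [L.Structure M] {α : Type} (x : α → M) (p : Set (ParamFormula L M α)) : Prop :=
  ∀ φ ∈ p, φ.Holds x

/-- `M` is `κ`-saturated: a set of formulas in finitely many variables, over a parameter set of
cardinality less than `κ`, is realized in `M` if all its finite subsets are. -/
def IsSaturated (L : FirstOrder.Language.{u, v}) (M : Type w) [L.Structure M] (κ : Cardinal.{w}) : Prop :=
  ∀ (A : Set M), #A < κ → ∀ (n : ℕ) (p : Set (ParamFormula L M (Fin n))),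
    (∀ φ ∈ p, φ.IsOver A) →
    (∀ q ⊆ p, q.Finite → ∃ x : Fin n → M, Realizes x q) →
    ∃ x : Fin n → M, Realizes x p

/-- The sentence
`∃ ȳ₀ … ∃ ȳₙ₋₁ ⋀_{η : n → {0,1}} ∃ x̄ ⋀_{k < n} φ(x̄, ȳₖ)^{η(k)}`. -/
noncomputable def independenceSentence {p q : ℕ} (φ : L.Formula (Fin p ⊕ Fin q)) (n : ℕ) :
    L.Sentence :=
  FirstOrder.Language.Formula.iExs (α := Empty) (Fin n × Fin q)
    (FirstOrder.Language.BoundedFormula.iInf fun η : Fin n → Bool =>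
      FirstOrder.Language.Formula.iExs (α := Empty ⊕ (Fin n × Fin q)) (Fin p)
        (FirstOrder.Language.BoundedFormula.iInf fun k : Fin n =>
          let ψ : L.Formula ((Empty ⊕ (Fin n × Fin q)) ⊕ Fin p) :=
            φ.relabel (Sum.elim Sum.inr fun j => Sum.inl (Sum.inr (k, j)))
          if η k then ψ else ψ.not))

theorem realize_independenceSentence [L.Structure M] {p q : ℕ} (φ : L.Formula (Fin p ⊕ Fin q))
    (n : ℕ) :
    M ⊨ independenceSentence φ n ↔
      ∃ y : Fin n → Fin q → M, ∀ η : Fin n → Bool, ∃ x : Fin p → M,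
        ∀ k, φ.Realize (Sum.elim x (y k)) ↔ η k = true := by
  have key : ∀ (y : Fin n × Fin q → M) (x : Fin p → M) (k : Fin n) (v : Empty → M),
      (Sum.elim (Sum.elim v y) x ∘
        (Sum.elim Sum.inr fun j => Sum.inl (Sum.inr (k, j)) :
          Fin p ⊕ Fin q → (Empty ⊕ (Fin n × Fin q)) ⊕ Fin p)) =
        Sum.elim x (fun j => y (k, j)) := by
    intro y x k v
    funext z
    cases z <;> rfl
  have key2 : ∀ (η : Fin n → Bool) (y : Fin n × Fin q → M) (x : Fin p → M) (k : Fin n)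
      (v : Empty → M),
      FirstOrder.Language.Formula.Realize
        (if η k then φ.relabel (Sum.elim Sum.inr fun j => Sum.inl (Sum.inr (k, j)))
          else (φ.relabel (Sum.elim Sum.inr fun j => Sum.inl (Sum.inr (k, j)))).not :
          L.Formula ((Empty ⊕ (Fin n × Fin q)) ⊕ Fin p)) (Sum.elim (Sum.elim v y) x) ↔
      (φ.Realize (Sum.elim x (fun j => y (k, j))) ↔ η k = true) := by
    intro η y x k v
    cases h : η k <;> simp [FirstOrder.Language.Formula.realize_relabel, key]
  unfold independenceSentence FirstOrder.Language.Sentence.Realize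
  rw [FirstOrder.Language.Formula.realize_iExs]
  constructor
  · rintro ⟨y, hy⟩
    refine ⟨fun k j => y (k, j), fun η => ?_⟩
    obtain ⟨x, hx⟩ := FirstOrder.Language.Formula.realize_iExs.1 (FirstOrder.Language.Formula.realize_iInf.1 hy η)
    exact ⟨x, fun k => (key2 η y x k _).1 (FirstOrder.Language.Formula.realize_iInf.1 hx k)⟩
  · rintro ⟨y, hy⟩
    refine ⟨fun z => y z.1 z.2, FirstOrder.Language.Formula.realize_iInf.2 fun η => ?_⟩
    obtain ⟨x, hx⟩ := hy η
    exact FirstOrder.Language.Formula.realize_iExs.2 ⟨x, FirstOrder.Language.Formula.realize_iInf.2 fun k =>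
      (key2 η _ x k _).2 (hx k)⟩

/-- A (complete) theory is dependent (NIP) if no formula `φ(x̄, ȳ)` is independent. Parameters in
`φ` may be absorbed into `x̄`, so they need not be allowed here. -/
def IsDependent (T : L.Theory) : Prop :=
  ∀ (p q : ℕ) (φ : L.Formula (Fin p ⊕ Fin q)), ¬ ∀ n : ℕ, T ⊨ᵇ independenceSentence φ n

/-- The set of all elements of `M` that occur in the tuples of the sequence `⟨a t : t ∈ I⟩`. -/
def elems {I : Type*} {m : ℕ} (a : I → Fin m → M) : Set M :=
  {c | ∃ t i, a t i = c}

/-- The sequence `⟨a t : t ∈ I⟩` of `m`-tuples is indiscernible over `A`. -/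
def IndiscernibleOver (L : FirstOrder.Language.{u, v}) [L.Structure M] {I : Type*} [LinearOrder I] {m : ℕ}
    (a : I → Fin m → M) (A : Set M) : Prop :=
  ∀ (n : ℕ) (φ : ParamFormula L M (Fin n × Fin m)), φ.IsOver A →
    ∀ i j : Fin n → I, StrictMono i → StrictMono j →
      (φ.Holds (fun z => a (i z.1) z.2) ↔ φ.Holds (fun z => a (j z.1) z.2))

/-- Two sequences are mutually indiscernible over `A`: each is indiscernible over the union of `A`
and the other one. -/
def MutuallyIndiscernibleOver (L : FirstOrder.Language.{u, v}) [L.Structure M] {I₁ I₂ : Type*}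
    [LinearOrder I₁] [LinearOrder I₂] {m₁ m₂ : ℕ}
    (b₁ : I₁ → Fin m₁ → M) (b₂ : I₂ → Fin m₂ → M) (A : Set M) : Prop :=
  IndiscernibleOver L b₁ (elems b₂ ∪ A) ∧ IndiscernibleOver L b₂ (elems b₁ ∪ A)

/-- The average `Av(A, a)` of the sequence `⟨a t : t ∈ I⟩` over `A`: the formulas over `A` that
hold of `a t` for every large enough `t ∈ I`. -/
def average (L : FirstOrder.Language.{u, v}) [L.Structure M] {I : Type*} [LinearOrder I] {m : ℕ}
    (A : Set M) (a : I → Fin m → M) : Set (ParamFormula L M (Fin m)) :=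
  {φ | φ.IsOver A ∧ ∀ᶠ t in Filter.atTop, φ.Holds (a t)}

/-- For `ℓ = 1, 2` and all `n`, the tuple `b^ℓ_n` realizes
`Av(A ∪ a¹ ∪ a² ∪ {b^k_m : m < n or (m = n and k < ℓ)}, a^ℓ)`. -/
def AlternatingAverages (L : FirstOrder.Language.{u, v}) [L.Structure M] {I₁ I₂ : Type*}
    [LinearOrder I₁] [LinearOrder I₂] {m₁ m₂ : ℕ}
    (a₁ : I₁ → Fin m₁ → M) (a₂ : I₂ → Fin m₂ → M) (A : Set M)
    (b₁ : ℕ → Fin m₁ → M) (b₂ : ℕ → Fin m₂ → M) : Prop :=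
  ∀ n : ℕ,
    Realizes (b₁ n)
      (average L (A ∪ elems a₁ ∪ elems a₂ ∪
        {c | ∃ m < n, ∃ i, b₁ m i = c} ∪ {c | ∃ m < n, ∃ i, b₂ m i = c}) a₁) ∧
    Realizes (b₂ n)
      (average L (A ∪ elems a₁ ∪ elems a₂ ∪
        {c | ∃ m ≤ n, ∃ i, b₁ m i = c} ∪ {c | ∃ m < n, ∃ i, b₂ m i = c}) a₂)

/-- Perpendicularity of two (endless, indiscernible) sequences. Here `M` is the monster model, and
`κ` is its degree of saturation: the parameter sets are the subsets of `M` of cardinality less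
than `κ`. -/
def Perpendicular (L : FirstOrder.Language.{u, v}) [L.Structure M] (κ : Cardinal.{w}) {I₁ I₂ : Type*}
    [LinearOrder I₁] [LinearOrder I₂] {m₁ m₂ : ℕ}
    (a₁ : I₁ → Fin m₁ → M) (a₂ : I₂ → Fin m₂ → M) : Prop :=
  ∀ A : Set M, #A < κ → ∃ (b₁ : ℕ → Fin m₁ → M) (b₂ : ℕ → Fin m₂ → M),
    AlternatingAverages L a₁ a₂ A b₁ b₂ ∧
      MutuallyIndiscernibleOver L b₁ b₂ (A ∪ elems a₁ ∪ elems a₂)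

/-- The iterated eventual truth values of `φ(x̄, ȳ)` along the two sequences exist and agree: for
some truth value `tv`, for every large enough `t ∈ I₁`, for every large enough `s ∈ I₂`, the truth
value of `φ[a₁ t, a₂ s]` is `tv`, and the same holds with the quantifiers in the other order. -/
def EventualValuesAgree [L.Structure M] {I₁ I₂ : Type*} [LinearOrder I₁] [LinearOrder I₂]
    {m₁ m₂ : ℕ} (a₁ : I₁ → Fin m₁ → M) (a₂ : I₂ → Fin m₂ → M)
    (φ : ParamFormula L M (Fin m₁ ⊕ Fin m₂)) : Prop :=
  ∃ tv : Bool,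
    (∀ᶠ t in Filter.atTop, ∀ᶠ s in Filter.atTop, φ.Holds (Sum.elim (a₁ t) (a₂ s)) ↔ tv = true) ∧
    (∀ᶠ s in Filter.atTop, ∀ᶠ t in Filter.atTop, φ.Holds (Sum.elim (a₁ t) (a₂ s)) ↔ tv = true)

end

end Dependent

namespace Dependent

/-! ### Formulas with parameters: substitution and splitting -/

section

variable {L : FirstOrder.Language.{u, v}} {M : Type w}

/-! Everything passes through (4), the commutation of iterated limits.

By NIP, no formula with parameters alternates cofinally along an endless indiscernible sequence:
otherwise its increasing tuples would show every truth pattern, and by indiscernibility one fixed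
tuple would carry all patterns (`HasNIP.hasLimits`). So averages are complete types, and a
realization can be traded for a far member of the sequence. If `b₁` realizes the average of `a₁`
over a set `B` containing both sequences, and `b₂` that of `a₂` over `B ∪ b₁`, then `φ[b₁, b₂]` is
the limit of `φ[a₁ t, a₂ s]` with `t` inner and `s` outer (`eventually_eventually_iff`); choosing in
the opposite order computes the other limit.

If the limits commute, the order of choice is irrelevant (`Realizes.exchange`), which is (3). In an
alternating construction, repeated exchange shows that each tuple realizes the average over the
earlier tuples of its own sequence and the whole other sequence; this yields mutual
indiscernibility, hence (1) and (2).

Conversely, (3) makes one pair compute both limits. Along alternating realizations, `φ[b₁ n, b₂ k]`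
is one limit for `n ≤ k` and the other for `k < n`. Under (1) the parameters of `φ` can be put into
`A`, and indiscernibility equates the two. Under (2) they cannot, but distinct limits would let
pairs with neighbouring indices realize every truth pattern, against NIP
(`AlternatingAverages.eventualValuesAgree_of_mutuallyIndiscernible`).

For (5), the whole model serves as submodel; conversely, parameters are replaced by a tuple of the
submodel with the same type over both sequences. -/

theorem ParamFormula.IsOver.mono {α : Type} {φ : ParamFormula L M α} {A B : Set M}
    (h : φ.IsOver A) (hAB : A ⊆ B) : φ.IsOver B := fun i => hAB (h i)

variable [L.Structure M]

/-- The negation of a formula with parameters. -/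
def ParamFormula.not {α : Type} (φ : ParamFormula L M α) : ParamFormula L M α :=
  ⟨φ.arity, φ.formula.not, φ.params⟩

theorem ParamFormula.holds_not {α : Type} (φ : ParamFormula L M α) (x : α → M) :
    φ.not.Holds x ↔ ¬ φ.Holds x := by
  simp [ParamFormula.not, ParamFormula.Holds, Language.Formula.realize_not]

/-- Substituting elements of `A` for some of the variables of a formula yields a formula over
`A`. -/
theorem ParamFormula.exists_substitution {α γ : Type} [Finite γ] (ψ : L.Formula γ) {A : Set M}
    (g : γ → α ⊕ M) (hg : ∀ z c, g z = Sum.inr c → c ∈ A) :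
    ∃ θ : ParamFormula L M α, θ.IsOver A ∧
      ∀ x, θ.Holds x ↔ ψ.Realize (fun z => Sum.elim x id (g z)) := by
  let e := Finite.equivFin {z // (g z).isRight}
  refine ⟨⟨Nat.card {z // (g z).isRight},
    ψ.relabel fun z => if h : (g z).isRight then Sum.inr (e ⟨z, h⟩)
      else Sum.inl ((g z).getLeft (by simpa using h)),
    fun i => (g (e.symm i)).getRight (e.symm i).2⟩, fun i => ?_, fun x => ?_⟩
  · exact hg (e.symm i) _ (by simp)
  · simp only [ParamFormula.Holds, Language.Formula.realize_relabel]
    refine iff_of_eq (congrArg _ (funext fun z => ?_))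
    by_cases h : (g z).isRight
    · obtain ⟨c, hc⟩ := Sum.isRight_iff.1 h
      simp [hc]
    · obtain ⟨c, hc⟩ := Sum.isLeft_iff.1 (by simpa using h : (g z).isLeft)
      simp [hc]

/-- Substituting elements of `A` for some of the variables of a formula over `A` yields a formula
over `A`. -/
theorem ParamFormula.exists_specialize {α δ : Type} [Finite δ] (φ : ParamFormula L M δ)
    {A : Set M} (hφ : φ.IsOver A) (g : δ → α ⊕ M) (hg : ∀ z c, g z = Sum.inr c → c ∈ A) :
    ∃ θ : ParamFormula L M α, θ.IsOver A ∧
      ∀ x, θ.Holds x ↔ φ.Holds (fun z => Sum.elim x id (g z)) := by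
  obtain ⟨θ, hθ, h⟩ := ParamFormula.exists_substitution φ.formula
    (Sum.elim g fun i => Sum.inr (φ.params i)) (A := A) (by
      rintro (z | i) c hc
      · exact hg z c hc
      · obtain rfl : φ.params i = c := by simpa using hc
        exact hφ i)
  refine ⟨θ, hθ, fun x => (h x).trans (iff_of_eq (congrArg _ (funext fun z => ?_)))⟩
  cases z <;> rfl

/-- A formula over `A ∪ b`, with `b` a tuple, is an instance at `b` of a formula over `A`. -/
theorem ParamFormula.exists_split {α : Type} [Finite α] {m : ℕ} (φ : ParamFormula L M α)
    {A : Set M} {b : Fin m → M} (hφ : φ.IsOver (A ∪ Set.range b)) :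
    ∃ θ : ParamFormula L M (α ⊕ Fin m), θ.IsOver A ∧
      ∀ x, θ.Holds (Sum.elim x b) ↔ φ.Holds x := by
  classical
  have hb : ∀ i, φ.params i ∉ A → ∃ j, b j = φ.params i := fun i hi => (hφ i).resolve_left hi
  obtain ⟨θ, hθ, h⟩ := ParamFormula.exists_substitution (A := A) φ.formula
    (Sum.elim (fun z => Sum.inl (Sum.inl z)) fun i =>
      if hi : φ.params i ∈ A then Sum.inr (φ.params i)
      else Sum.inl (Sum.inr (hb i hi).choose)) (by
      rintro (z | i) c hc
      · simp at hc
      · by_cases hi : φ.params i ∈ A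
        · simp only [Sum.elim_inr, dif_pos hi, Sum.inr.injEq] at hc
          exact hc ▸ hi
        · simp [dif_neg hi] at hc)
  refine ⟨θ, hθ, fun x => (h _).trans (iff_of_eq (congrArg _ (funext fun z => ?_)))⟩
  rcases z with z | i
  · rfl
  · by_cases hi : φ.params i ∈ A
    · simp [dif_pos hi]
    · simpa [dif_neg hi] using (hb i hi).choose_spec

/-- In the formula `φ(x̄, ȳ)`, substitute the tuple `x` for `x̄`. -/
theorem ParamFormula.exists_substLeft {m₁ m₂ : ℕ} (φ : ParamFormula L M (Fin m₁ ⊕ Fin m₂))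
    {A : Set M} (hφ : φ.IsOver A) (x : Fin m₁ → M) (hx : ∀ i, x i ∈ A) :
    ∃ θ : ParamFormula L M (Fin m₂), θ.IsOver A ∧
      ∀ y, θ.Holds y ↔ φ.Holds (Sum.elim x y) := by
  obtain ⟨θ, hθ, h⟩ := φ.exists_specialize hφ (Sum.elim (fun i => Sum.inr (x i)) Sum.inl) (by
    rintro (z | i) c hc
    · obtain rfl : x z = c := by simpa using hc
      exact hx z
    · simp at hc)
  refine ⟨θ, hθ, fun y => (h y).trans (iff_of_eq (congrArg _ (funext fun z => ?_)))⟩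
  cases z <;> rfl

/-- In the formula `φ(x̄, ȳ)`, substitute the tuple `y` for `ȳ`. -/
theorem ParamFormula.exists_substRight {m₁ m₂ : ℕ} (φ : ParamFormula L M (Fin m₁ ⊕ Fin m₂))
    {A : Set M} (hφ : φ.IsOver A) (y : Fin m₂ → M) (hy : ∀ i, y i ∈ A) :
    ∃ θ : ParamFormula L M (Fin m₁), θ.IsOver A ∧
      ∀ x, θ.Holds x ↔ φ.Holds (Sum.elim x y) := by
  obtain ⟨θ, hθ, h⟩ := φ.exists_specialize hφ (Sum.elim Sum.inl fun i => Sum.inr (y i)) (by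
    rintro (z | i) c hc
    · simp at hc
    · obtain rfl : y i = c := by simpa using hc
      exact hy i)
  refine ⟨θ, hθ, fun x => (h x).trans (iff_of_eq (congrArg _ (funext fun z => ?_)))⟩
  cases z <;> rfl

/-- Exchange the two tuples of variables of a formula. -/
def ParamFormula.swap {α β : Type} (φ : ParamFormula L M (α ⊕ β)) : ParamFormula L M (β ⊕ α) :=
  ⟨φ.arity, φ.formula.relabel (Sum.map Sum.swap id), φ.params⟩

theorem ParamFormula.holds_swap {α β : Type} (φ : ParamFormula L M (α ⊕ β))
    (x : α → M) (y : β → M) : φ.swap.Holds (Sum.elim y x) ↔ φ.Holds (Sum.elim x y) := by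
  simp only [ParamFormula.swap, ParamFormula.Holds, Language.Formula.realize_relabel]
  refine iff_of_eq (congrArg _ (funext fun z => ?_))
  rcases z with (z | z) | z <;> rfl

/-! ### NIP and limits along indiscernible sequences -/

/-- The formula `∃ x̄ ⋀_{k < n} χ(x̄, ȳₖ)^{η(k)}` in the variables `ȳ₀, …, ȳₙ₋₁`. -/
noncomputable def patternFormula {p : ℕ} {γ : Type} (χ : L.Formula (Fin p ⊕ γ)) {n : ℕ}
    (η : Fin n → Bool) : L.Formula (Fin n × γ) :=
  Language.Formula.iExs (Fin p) (Language.Formula.iInf fun k =>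
    let ψ : L.Formula ((Fin n × γ) ⊕ Fin p) :=
      χ.relabel (Sum.elim Sum.inr fun j => Sum.inl (k, j))
    if η k then ψ else ψ.not)

theorem realize_patternFormula {p : ℕ} {γ : Type} (χ : L.Formula (Fin p ⊕ γ)) {n : ℕ}
    (η : Fin n → Bool) (v : Fin n × γ → M) :
    (patternFormula χ η).Realize v ↔
      ∃ x : Fin p → M, ∀ k, χ.Realize (Sum.elim x fun j => v (k, j)) ↔ η k = true := by
  unfold patternFormula
  rw [Language.Formula.realize_iExs]
  refine exists_congr fun x => ?_
  rw [Language.Formula.realize_iInf]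
  refine forall_congr' fun k => ?_
  have key : (Sum.elim v x ∘ (Sum.elim Sum.inr fun j => Sum.inl (k, j) :
      Fin p ⊕ γ → (Fin n × γ) ⊕ Fin p)) = Sum.elim x fun j => v (k, j) := by
    funext z
    cases z <;> rfl
  cases h : η k <;> simp [Language.Formula.realize_relabel, key]

/-- The structure `M` has no independent formula. -/
def HasNIP (L : FirstOrder.Language.{u, v}) (M : Type w) [L.Structure M] : Prop :=
  ∀ (p : ℕ) (γ : Type) [Finite γ] (χ : L.Formula (Fin p ⊕ γ)), ∃ n : ℕ,
    ∀ v : Fin n × γ → M, ∃ η : Fin n → Bool, ¬ (patternFormula χ η).Realize v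

/-- By completeness, an independence sentence true in the nonempty model `M` is a consequence of
`T`, so independence in `M` would be independence in `T`. -/
theorem IsDependent.hasNIP {T : L.Theory} (hdep : IsDependent T) (hT : T.IsComplete)
    [M ⊨ T] [Nonempty M] : HasNIP L M := by
  intro p γ _ χ
  by_contra! hcon
  let e := Finite.equivFin γ
  refine hdep p (Nat.card γ) (χ.relabel (Sum.map id e)) fun n => ?_
  rw [← hT.realize_sentence_iff _ M, realize_independenceSentence]
  obtain ⟨v, hv⟩ := hcon n
  refine ⟨fun k j => v (k, e.symm j), fun η => ?_⟩
  obtain ⟨x, hx⟩ := (realize_patternFormula χ η v).1 (hv η)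
  refine ⟨x, fun k => ?_⟩
  rw [← hx k, Language.Formula.realize_relabel]
  refine iff_of_eq (congrArg _ (funext fun z => ?_))
  cases z <;> simp

/-- The truth value of every formula with parameters is eventually constant along `a`. -/
def HasLimits (L : FirstOrder.Language.{u, v}) [L.Structure M] {I : Type*} [LinearOrder I] {m : ℕ}
    (a : I → Fin m → M) : Prop :=
  ∀ φ : ParamFormula L M (Fin m),
    (∀ᶠ t in Filter.atTop, φ.Holds (a t)) ∨ ∀ᶠ t in Filter.atTop, ¬ φ.Holds (a t)

theorem IndiscernibleOver.realize_iff {I : Type*} [LinearOrder I] {m : ℕ} {a : I → Fin m → M}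
    {A : Set M} (ha : IndiscernibleOver L a A) {n : ℕ} {γ : Type} [Finite γ]
    (ψ : L.Formula ((Fin n × Fin m) ⊕ γ)) (c : γ → M) (hc : ∀ z, c z ∈ A) {i j : Fin n → I}
    (hi : StrictMono i) (hj : StrictMono j) :
    ψ.Realize (Sum.elim (fun z => a (i z.1) z.2) c) ↔
      ψ.Realize (Sum.elim (fun z => a (j z.1) z.2) c) := by
  obtain ⟨θ, hθ, h⟩ := ParamFormula.exists_substitution (A := A) (α := Fin n × Fin m) ψ
    (Sum.elim Sum.inl fun z => Sum.inr (c z)) (by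
      rintro (z | z) d hd
      · simp at hd
      · obtain rfl : c z = d := by simpa using hd
        exact hc z)
  have h' : ∀ x, θ.Holds x ↔ ψ.Realize (Sum.elim x c) := fun x =>
    (h x).trans (iff_of_eq (congrArg _ (funext fun z => by cases z <;> rfl)))
  rw [← h', ← h']
  exact ha n θ hθ i j hi hj

/-- If both `P` and its negation hold arbitrarily far, then some increasing finite sequence
realizes any given pattern of truth values of `P`. -/
theorem exists_strictMono_pattern {I : Type*} [LinearOrder I] [Nonempty I] [NoMaxOrder I]
    {P : I → Prop}
    (h : ∀ b : Bool, ∀ t₀, ∃ t > t₀, P t ↔ b = true) (n : ℕ) (η : Fin n → Bool) :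
    ∃ i : Fin n → I, StrictMono i ∧ ∀ k, P (i k) ↔ η k = true := by
  choose f hf hP using h
  -- The pattern is extended to `ℕ` to allow plain recursion; its values from `n` on are irrelevant.
  let η' : ℕ → Bool := fun k => if hk : k < n then η ⟨k, hk⟩ else true
  let s : ℕ → I := fun k => Nat.rec (f (η' 0) (Classical.arbitrary I)) (fun k t => f (η' (k + 1)) t) k
  refine ⟨fun k => s k, fun k l hkl => strictMono_nat_of_lt_succ (fun k => hf _ _) hkl,
    fun k => ?_⟩
  have : η k = η' k := by simp [η']
  rw [this]
  rcases k with ⟨_ | k, hk⟩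
  · exact hP _ _
  · exact hP _ _

theorem HasNIP.hasLimits (hM : HasNIP L M) {I : Type*} [LinearOrder I] [Nonempty I] [NoMaxOrder I]
    {m : ℕ} {a : I → Fin m → M} (ha : IndiscernibleOver L a ∅) : HasLimits L a := by
  intro φ
  by_contra hcon
  rw [not_or] at hcon
  obtain ⟨h₁, h₂⟩ := hcon
  have hpat : ∀ b : Bool, ∀ t₀, ∃ t > t₀, φ.Holds (a t) ↔ b = true := by
    rintro (_ | _) t₀
    · by_contra! h
      exact h₁ ((Filter.eventually_gt_atTop t₀).mono fun t ht => by simpa using h t ht)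
    · by_contra! h
      exact h₂ ((Filter.eventually_gt_atTop t₀).mono fun t ht => by simpa using h t ht)
  -- The roles are exchanged: the parameters of `φ` become the single witness `x̄`, and members of
  -- the sequence become the `ȳₖ`.
  obtain ⟨n, hn⟩ := hM φ.arity (Fin m) (φ.formula.relabel Sum.swap)
  obtain ⟨j, hj, -⟩ := exists_strictMono_pattern hpat n fun _ => true
  obtain ⟨η, hη⟩ := hn fun z => a (j z.1) z.2
  obtain ⟨i, hi, hiη⟩ := exists_strictMono_pattern hpat n η
  refine hη ?_
  have key := ha.realize_iff ((patternFormula (φ.formula.relabel Sum.swap) η).relabel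
    (Sum.inl : _ → _ ⊕ Empty)) Empty.elim (fun z => z.elim) hi hj
  simp only [Language.Formula.realize_relabel, Sum.elim_comp_inl] at key
  rw [← key, realize_patternFormula]
  refine ⟨φ.params, fun k => ?_⟩
  rw [← hiη k, Language.Formula.realize_relabel]
  refine iff_of_eq (congrArg _ (funext fun z => ?_))
  cases z <;> rfl

end

/-! ### Averages, exchange and mutual indiscernibility -/

section

variable {L : FirstOrder.Language.{u, v}} {M : Type w} [L.Structure M]
variable {I : Type*} [LinearOrder I]
variable {I₁ I₂ : Type*} [LinearOrder I₁] [LinearOrder I₂]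
variable {m m₁ m₂ : ℕ} {a : I → Fin m → M} {a₁ : I₁ → Fin m₁ → M} {a₂ : I₂ → Fin m₂ → M}

theorem mem_elems {J : Type*} (c : J → Fin m → M) (t : J) (i : Fin m) : c t i ∈ elems c :=
  ⟨t, i, rfl⟩

theorem Realizes.average_mono {x : Fin m → M} {A B : Set M} (h : Realizes x (average L B a))
    (hAB : A ⊆ B) : Realizes x (average L A a) :=
  fun φ hφ => h φ ⟨hφ.1.mono hAB, hφ.2⟩

/-- Existence of limits makes the average a complete type: it contains each formula over `A` or its
negation. -/
theorem Realizes.eventually_iff {x : Fin m → M} {A : Set M} (h : Realizes x (average L A a))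
    (ha : HasLimits L a) {φ : ParamFormula L M (Fin m)} (hφ : φ.IsOver A) :
    ∀ᶠ t in Filter.atTop, (φ.Holds (a t) ↔ φ.Holds x) := by
  rcases ha φ with h' | h'
  · have := h φ ⟨hφ, h'⟩
    exact h'.mono fun t ht => iff_of_true ht this
  · have := h φ.not ⟨hφ, by simpa only [ParamFormula.holds_not] using h'⟩
    rw [ParamFormula.holds_not] at this
    exact h'.mono fun t ht => iff_of_false ht this

/-- A tuple that realizes the average over every member of a chain of sets realizes the average
over its union. -/
theorem Realizes.average_iUnion {x : Fin m → M} {D : ℕ → Set M} (hD : Monotone D)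
    (h : ∀ k, Realizes x (average L (D k) a)) : Realizes x (average L (⋃ k, D k) a) := by
  rintro φ ⟨hφ, hlim⟩
  choose f hf using fun i => Set.mem_iUnion.1 (hφ i)
  exact h (Finset.univ.sup f) φ ⟨fun i => hD (Finset.le_sup (Finset.mem_univ i)) (hf i), hlim⟩

/-- If `b₁` realizes the average of `a₁` over `B`, and `b₂` the average of `a₂` over `B ∪ b₁`,
then the truth value of `φ[b₁, b₂]` is an iterated eventual truth value. -/
theorem eventually_eventually_iff (h₁ : HasLimits L a₁) (h₂ : HasLimits L a₂) {B : Set M}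
    (hB : elems a₂ ⊆ B) {b₁ : Fin m₁ → M} {b₂ : Fin m₂ → M}
    (hb₁ : Realizes b₁ (average L B a₁))
    (hb₂ : Realizes b₂ (average L (B ∪ Set.range b₁) a₂))
    {φ : ParamFormula L M (Fin m₁ ⊕ Fin m₂)} (hφ : φ.IsOver B) :
    ∀ᶠ s in Filter.atTop, ∀ᶠ t in Filter.atTop,
      (φ.Holds (Sum.elim (a₁ t) (a₂ s)) ↔ φ.Holds (Sum.elim b₁ b₂)) := by
  obtain ⟨θ, hθ, h⟩ := φ.exists_substLeft (hφ.mono Set.subset_union_left) b₁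
    (fun i => Or.inr (Set.mem_range_self i) : ∀ i, b₁ i ∈ B ∪ Set.range b₁)
  filter_upwards [hb₂.eventually_iff h₂ hθ] with s hs
  -- With `b₂` traded for `a₂ s`, which lies in `B`, the formula is over `B` and `b₁` can be traded
  -- in turn.
  obtain ⟨θ', hθ', h'⟩ := φ.exists_substRight hφ (a₂ s) fun i => hB (mem_elems a₂ s i)
  filter_upwards [hb₁.eventually_iff h₁ hθ'] with t ht
  rw [← h', ht, h', ← h, hs, h]

theorem eventualValuesAgree_swap {φ : ParamFormula L M (Fin m₁ ⊕ Fin m₂)} :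
    EventualValuesAgree a₂ a₁ φ.swap ↔ EventualValuesAgree a₁ a₂ φ := by
  simp only [EventualValuesAgree, ParamFormula.holds_swap, and_comm]

/-- If the iterated eventual truth values of all formulas agree, realizations of the two averages
can be exchanged. -/
theorem Realizes.exchange [Nonempty I₁] [Nonempty I₂]
    (h₁ : HasLimits L a₁) (h₂ : HasLimits L a₂)
    (hagree : ∀ φ : ParamFormula L M (Fin m₁ ⊕ Fin m₂), EventualValuesAgree a₁ a₂ φ)
    {B : Set M} (hB₁ : elems a₁ ⊆ B) (hB₂ : elems a₂ ⊆ B) {b₁ : Fin m₁ → M} {b₂ : Fin m₂ → M}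
    (hb₁ : Realizes b₁ (average L B a₁))
    (hb₂ : Realizes b₂ (average L (B ∪ Set.range b₁) a₂)) :
    Realizes b₁ (average L (B ∪ Set.range b₂) a₁) := by
  rintro φ ⟨hφ, hlim⟩
  obtain ⟨θ, hθ, h⟩ := φ.exists_split hφ
  -- The limit with `t` outer is true; by agreement so is the one with `s` outer, whose value is
  -- `θ[b₁, b₂]`.
  have key : ∀ᶠ t in Filter.atTop, ∀ᶠ s in Filter.atTop, θ.Holds (Sum.elim (a₁ t) (a₂ s)) := by
    filter_upwards [hlim] with t ht
    obtain ⟨θ', hθ', h'⟩ := θ.exists_substLeft hθ (a₁ t) fun i => hB₁ (mem_elems a₁ t i)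
    filter_upwards [(hb₂.average_mono Set.subset_union_left).eventually_iff h₂ hθ'] with s hs
    rw [← h', hs, h', h]
    exact ht
  obtain ⟨tv, hts, hst⟩ := hagree θ
  obtain ⟨t, ht, ht'⟩ := (key.and hts).exists
  obtain ⟨s, hs, hs'⟩ := (ht.and ht').exists
  have htv := hs'.1 hs
  obtain ⟨s, hs, hs'⟩ :=
    (hst.and (eventually_eventually_iff h₁ h₂ hB₂ hb₁ hb₂ hθ)).exists
  obtain ⟨t, ht, ht'⟩ := (hs.and hs').exists
  rw [← h, ← ht', ht, htv]

/-- A sequence whose members realize successive averages over a set `D` containing the original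
sequence is indiscernible over `D`. -/
theorem indiscernibleOver_of_realizes [Nonempty I] (ha : HasLimits L a) {D : Set M}
    (hD : elems a ⊆ D) {b : ℕ → Fin m → M}
    (hb : ∀ n, Realizes (b n) (average L (D ∪ {c | ∃ k < n, ∃ i, b k i = c}) a)) :
    IndiscernibleOver L b D := by
  intro n
  induction n with
  | zero =>
    intro φ _ i j _ _
    refine iff_of_eq (congrArg _ (funext fun z => z.1.elim0))
  | succ n ih =>
    intro φ hφ i j hi hj
    -- The last tuple realizes the average over `D` and all earlier ones, so a far `a t` can replace
    -- it.
    have last : ∀ i : Fin (n + 1) → ℕ, StrictMono i → ∀ᶠ t in Filter.atTop,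
        (φ.Holds (fun z => (Fin.snoc (fun k : Fin n => b (i k.castSucc)) (a t) :
            Fin (n + 1) → Fin m → M) z.1 z.2) ↔ φ.Holds (fun z => b (i z.1) z.2)) := by
      intro i hi
      obtain ⟨θ, hθ, h⟩ := φ.exists_specialize (α := Fin m)
        (A := D ∪ {c | ∃ k < i (Fin.last n), ∃ j, b k j = c}) (hφ.mono Set.subset_union_left)
        (fun z => Fin.lastCases (motive := fun _ => Fin m ⊕ M) (Sum.inl z.2)
          (fun k => Sum.inr (b (i k.castSucc) z.2)) z.1) (by
          rintro ⟨k, l⟩ c hc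
          induction k using Fin.lastCases with
          | last => simp at hc
          | cast k =>
            simp only [Fin.lastCases_castSucc, Sum.inr.injEq] at hc
            exact Or.inr ⟨i k.castSucc, hi (Fin.castSucc_lt_last k), l, hc⟩)
      have h' : ∀ x, θ.Holds x ↔ φ.Holds (fun z => (Fin.snoc
          (fun k : Fin n => b (i k.castSucc)) x : Fin (n + 1) → Fin m → M) z.1 z.2) := by
        refine fun x => (h x).trans (iff_of_eq (congrArg _ (funext fun z => ?_)))
        obtain ⟨k, l⟩ := z
        induction k using Fin.lastCases <;> simp
      filter_upwards [(hb (i (Fin.last n))).eventually_iff ha hθ] with t ht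
      rw [← h', ht, h']
      refine iff_of_eq (congrArg _ (funext fun z => ?_))
      obtain ⟨k, l⟩ := z
      induction k using Fin.lastCases <;> simp
    -- The same `a t` serves both index tuples; as it lies in `D`, it becomes a parameter and the
    -- induction hypothesis applies.
    obtain ⟨t, hti, htj⟩ := ((last i hi).and (last j hj)).exists
    rw [← hti, ← htj]
    obtain ⟨θ, hθ, h⟩ := φ.exists_specialize (α := Fin n × Fin m) hφ
      (fun z => Fin.lastCases (motive := fun _ => (Fin n × Fin m) ⊕ M) (Sum.inr (a t z.2))
        (fun k => Sum.inl (k, z.2)) z.1) (by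
        rintro ⟨k, l⟩ c hc
        induction k using Fin.lastCases with
        | last =>
          simp only [Fin.lastCases_last, Sum.inr.injEq] at hc
          exact hc ▸ hD (mem_elems a t l)
        | cast k => simp at hc)
    have h' : ∀ x : Fin n → Fin m → M, θ.Holds (fun z => x z.1 z.2) ↔ φ.Holds (fun z =>
        (Fin.snoc x (a t) : Fin (n + 1) → Fin m → M) z.1 z.2) := by
      refine fun x => (h _).trans (iff_of_eq (congrArg _ (funext fun z => ?_)))
      obtain ⟨k, l⟩ := z
      induction k using Fin.lastCases <;> simp
    rw [← h', ← h']
    exact ih θ hθ (fun k => i k.castSucc) (fun k => j k.castSucc)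
      (hi.comp (Fin.strictMono_castSucc)) (hj.comp (Fin.strictMono_castSucc))

/-- Exchange adds the later tuples of the other sequence, one at a time, to the set over which a
given tuple realizes its average. -/
theorem AlternatingAverages.mutuallyIndiscernibleOver [Nonempty I₁] [Nonempty I₂]
    (h₁ : HasLimits L a₁) (h₂ : HasLimits L a₂)
    (hagree : ∀ φ : ParamFormula L M (Fin m₁ ⊕ Fin m₂), EventualValuesAgree a₁ a₂ φ)
    {A : Set M} {b₁ : ℕ → Fin m₁ → M} {b₂ : ℕ → Fin m₂ → M}
    (hb : AlternatingAverages L a₁ a₂ A b₁ b₂) :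
    MutuallyIndiscernibleOver L b₁ b₂ (A ∪ elems a₁ ∪ elems a₂) := by
  set B := A ∪ elems a₁ ∪ elems a₂ with hBdef
  have hB₁ : elems a₁ ⊆ B := fun c hc => Or.inl (Or.inr hc)
  have hB₂ : elems a₂ ⊆ B := fun c hc => Or.inr hc
  have hagree' : ∀ φ : ParamFormula L M (Fin m₂ ⊕ Fin m₁), EventualValuesAgree a₂ a₁ φ :=
    fun φ => eventualValuesAgree_swap.1 (hagree φ.swap)
  let D₁ : ℕ → Set M := fun n => {c | ∃ k < n, ∃ i, b₁ k i = c}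
  let D₂ : ℕ → Set M := fun n => {c | ∃ k < n, ∃ i, b₂ k i = c}
  have mono₁ : Monotone D₁ := fun n k hnk c ⟨l, hl, i, hi⟩ => ⟨l, hl.trans_le hnk, i, hi⟩
  have mono₂ : Monotone D₂ := fun n k hnk c ⟨l, hl, i, hi⟩ => ⟨l, hl.trans_le hnk, i, hi⟩
  have hb₁ : ∀ n, Realizes (b₁ n) (average L (B ∪ D₁ n ∪ D₂ n) a₁) := fun n => (hb n).1
  have hb₂ : ∀ n, Realizes (b₂ n) (average L (B ∪ D₁ (n + 1) ∪ D₂ n) a₂) := fun n =>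
    (hb n).2.average_mono (by simp only [D₁, D₂, Nat.lt_succ_iff]; exact subset_rfl)
  have succ₁ : ∀ n, D₁ (n + 1) ⊆ D₁ n ∪ Set.range (b₁ n) := by
    rintro n c ⟨k, hk, i, rfl⟩
    rcases (Nat.lt_succ_iff.1 hk).lt_or_eq with hk | rfl
    · exact Or.inl ⟨k, hk, i, rfl⟩
    · exact Or.inr ⟨i, rfl⟩
  have succ₂ : ∀ n, D₂ (n + 1) ⊆ D₂ n ∪ Set.range (b₂ n) := by
    rintro n c ⟨k, hk, i, rfl⟩
    rcases (Nat.lt_succ_iff.1 hk).lt_or_eq with hk | rfl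
    · exact Or.inl ⟨k, hk, i, rfl⟩
    · exact Or.inr ⟨i, rfl⟩
  have mem₁ : ∀ {n k}, n < k → Set.range (b₁ n) ⊆ D₁ k := by
    rintro n k hnk _ ⟨i, rfl⟩
    exact ⟨n, hnk, i, rfl⟩
  have mem₂ : ∀ {n k}, n < k → Set.range (b₂ n) ⊆ D₂ k := by
    rintro n k hnk _ ⟨i, rfl⟩
    exact ⟨n, hnk, i, rfl⟩
  have hc₁ : ∀ n k, Realizes (b₁ n) (average L (B ∪ D₁ n ∪ D₂ (n + k)) a₁) := by
    intro n k
    induction k with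
    | zero => exact hb₁ n
    | succ k ih =>
      refine (Realizes.exchange h₁ h₂ hagree (fun c hc => Or.inl (Or.inl (hB₁ hc)))
        (fun c hc => Or.inl (Or.inl (hB₂ hc))) ih
        ((hb₂ (n + k)).average_mono ?_)).average_mono ?_
      · rintro c (((hc | hc) | hc) | hc)
        · exact Or.inl (Or.inl hc)
        · exact Or.inl (Or.inr (mono₁ (by omega) hc))
        · exact Or.inr hc
        · exact Or.inl (Or.inr (mem₁ (by omega) hc))
      · rintro c (hc | hc)
        · exact Or.inl (Or.inl hc)
        · exact (succ₂ _ hc).imp_left Or.inr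
  -- The offset `n + 1` reflects that `b₂ n` is chosen after `b₁ n`.
  have hc₂ : ∀ n k, Realizes (b₂ n) (average L (B ∪ D₂ n ∪ D₁ (n + 1 + k)) a₂) := by
    intro n k
    induction k with
    | zero =>
      refine (hb₂ n).average_mono ?_
      rw [Set.union_right_comm]
    | succ k ih =>
      refine (Realizes.exchange h₂ h₁ hagree' (fun c hc => Or.inl (Or.inl (hB₂ hc)))
        (fun c hc => Or.inl (Or.inl (hB₁ hc))) ih
        ((hb₁ (n + 1 + k)).average_mono ?_)).average_mono ?_
      · rintro c (((hc | hc) | hc) | hc)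
        · exact Or.inl (Or.inl hc)
        · exact Or.inr (mono₂ (by omega) hc)
        · exact Or.inl (Or.inr hc)
        · exact Or.inr (mem₂ (by omega) hc)
      · rintro c (hc | hc)
        · exact Or.inl (Or.inl hc)
        · exact (succ₁ _ hc).imp_left Or.inr
  constructor
  · refine indiscernibleOver_of_realizes h₁ (hB₁.trans Set.subset_union_right) fun n => ?_
    refine (Realizes.average_iUnion (fun k l hkl => Set.union_subset_union_right _
      (mono₂ (Nat.add_le_add_left hkl n))) (hc₁ n)).average_mono ?_
    rintro c ((⟨k, i, rfl⟩ | hc) | hc)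
    · exact Set.mem_iUnion.2 ⟨k + 1, Or.inr ⟨k, by omega, i, rfl⟩⟩
    · exact Set.mem_iUnion.2 ⟨0, Or.inl (Or.inl hc)⟩
    · exact Set.mem_iUnion.2 ⟨0, Or.inl (Or.inr hc)⟩
  · refine indiscernibleOver_of_realizes h₂ (hB₂.trans Set.subset_union_right) fun n => ?_
    refine (Realizes.average_iUnion (fun k l hkl => Set.union_subset_union_right _
      (mono₁ (Nat.add_le_add_left hkl (n + 1)))) (hc₂ n)).average_mono ?_
    rintro c ((⟨k, i, rfl⟩ | hc) | hc)
    · exact Set.mem_iUnion.2 ⟨k, Or.inr ⟨k, by omega, i, rfl⟩⟩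
    · exact Set.mem_iUnion.2 ⟨0, Or.inl (Or.inl hc)⟩
    · exact Set.mem_iUnion.2 ⟨0, Or.inl (Or.inr hc)⟩

end

/-! ### Saturation and alternating realizations -/

section

variable {L : FirstOrder.Language.{u, v}} {M : Type w} [L.Structure M]
variable {I₁ I₂ : Type*} [LinearOrder I₁] [LinearOrder I₂]
variable {m m₁ m₂ : ℕ} {a₁ : I₁ → Fin m₁ → M} {a₂ : I₂ → Fin m₂ → M}

/-- Far enough members of the sequence satisfy any finite part of its average. -/
theorem IsSaturated.exists_realizes {κ : Cardinal.{w}} (hM : IsSaturated L M κ)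
    {I : Type*} [LinearOrder I] [Nonempty I] (a : I → Fin m → M) {A : Set M} (hA : #A < κ) :
    ∃ x, Realizes x (average L A a) := by
  refine hM A hA m _ (fun φ hφ => hφ.1) fun q hq hfin => ?_
  obtain ⟨t, ht⟩ := ((Filter.eventually_all_finite hfin).2 fun φ hφ => (hq hφ).2).exists
  exact ⟨a t, ht⟩

theorem mk_range_fin_lt {κ : Cardinal.{w}} (hκ : ℵ₀ ≤ κ) (x : Fin m → M) :
    #(Set.range x) < κ :=
  ((Set.finite_range x).lt_aleph0).trans_le hκ

theorem mk_union_lt {κ : Cardinal.{w}} (hκ : ℵ₀ ≤ κ) {A B : Set M} (hA : #A < κ) (hB : #B < κ) :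
    #(A ∪ B : Set M) < κ :=
  (mk_union_le A B).trans_lt (add_lt_of_lt hκ hA hB)

theorem mk_elems_le {I : Type w} [Infinite I] (a : I → Fin m → M) : #(elems a) ≤ #I := by
  have h : elems a = Set.range fun z : I × Fin m => a z.1 z.2 := by
    ext c
    simp [elems]
  rw [h]
  refine mk_range_le.trans ?_
  rw [mk_prod, lift_uzero, mk_fin, lift_natCast]
  exact mul_le_of_le (aleph0_le_mk I) le_rfl (natCast_le_aleph0.trans (aleph0_le_mk I))

/-- In a saturated model there are alternating realizations of the averages. -/
theorem IsSaturated.exists_alternatingAverages [Nonempty I₁] [Nonempty I₂]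
    {κ : Cardinal.{w}} (hκ : ℵ₀ ≤ κ)
    (hM : IsSaturated L M κ) {A : Set M} (hA : #A < κ) (h₁ : #(elems a₁) < κ)
    (h₂ : #(elems a₂) < κ) : ∃ b₁ b₂, AlternatingAverages L a₁ a₂ A b₁ b₂ := by
  -- Made total in `S`, with a junk value on large sets, so that choice gives a function to iterate.
  have ex₁ : ∀ S : Set M, ∃ x, #S < κ → Realizes x (average L S a₁) := fun S => by
    by_cases hS : #S < κ
    · exact (hM.exists_realizes a₁ hS).imp fun x hx _ => hx
    · exact ⟨a₁ (Classical.arbitrary I₁), fun h => absurd h hS⟩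
  have ex₂ : ∀ S : Set M, ∃ x, #S < κ → Realizes x (average L S a₂) := fun S => by
    by_cases hS : #S < κ
    · exact (hM.exists_realizes a₂ hS).imp fun x hx _ => hx
    · exact ⟨a₂ (Classical.arbitrary I₂), fun h => absurd h hS⟩
  choose f₁ hf₁ using ex₁
  choose f₂ hf₂ using ex₂
  let mid : Set M → Set M := fun S => S ∪ Set.range (f₁ S)
  -- `S n` collects everything present before stage `n`; `mid` adds the first tuple of the stage.
  let S : ℕ → Set M := fun n => Nat.rec (A ∪ elems a₁ ∪ elems a₂)
    (fun _ S' => mid S' ∪ Set.range (f₂ (mid S'))) n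
  have hmid : ∀ S : Set M, #S < κ → #(mid S) < κ := fun S hS =>
    mk_union_lt hκ hS (mk_range_fin_lt hκ _)
  have hS : ∀ n, #↥(S n) < κ := by
    intro n
    induction n with
    | zero => exact mk_union_lt hκ (mk_union_lt hκ hA h₁) h₂
    | succ n ih => exact mk_union_lt hκ (hmid _ ih) (mk_range_fin_lt hκ _)
  have hmono : Monotone S := monotone_nat_of_le_succ fun n c hc => Or.inl (Or.inl hc)
  have mem₁ : ∀ k i, f₁ (S k) i ∈ S (k + 1) := fun k i => Or.inl (Or.inr ⟨i, rfl⟩)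
  have mem₂ : ∀ k i, f₂ (mid (S k)) i ∈ S (k + 1) := fun k i => Or.inr ⟨i, rfl⟩
  refine ⟨fun n => f₁ (S n), fun n => f₂ (mid (S n)), fun n =>
    ⟨(hf₁ _ (hS n)).average_mono ?_, (hf₂ _ (hmid _ (hS n))).average_mono ?_⟩⟩
  · rintro c ((hc | ⟨k, hk, i, rfl⟩) | ⟨k, hk, i, rfl⟩)
    · exact hmono (Nat.zero_le n) hc
    · exact hmono hk (mem₁ k i)
    · exact hmono hk (mem₂ k i)
  · rintro c ((hc | ⟨k, hk, i, rfl⟩) | ⟨k, hk, i, rfl⟩)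
    · exact Or.inl (hmono (Nat.zero_le n) hc)
    · rcases hk.lt_or_eq with hk | rfl
      · exact Or.inl (hmono hk (mem₁ k i))
      · exact Or.inr ⟨i, rfl⟩
    · exact Or.inl (hmono hk (mem₂ k i))

theorem AlternatingAverages.mono {A A' : Set M} {b₁ : ℕ → Fin m₁ → M} {b₂ : ℕ → Fin m₂ → M}
    (hb : AlternatingAverages L a₁ a₂ A b₁ b₂) (hA : A' ⊆ A) :
    AlternatingAverages L a₁ a₂ A' b₁ b₂ := fun n =>
  ⟨(hb n).1.average_mono (by gcongr), (hb n).2.average_mono (by gcongr)⟩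

/-! ### Reading off the iterated limits from alternating realizations -/

/-- Along alternating realizations of the averages, `φ[b₁ n, b₂ k]` takes one of the two iterated
eventual truth values if `n ≤ k`. -/
theorem AlternatingAverages.eventually_iff_of_le (h₁ : HasLimits L a₁) (h₂ : HasLimits L a₂)
    {A : Set M} {b₁ : ℕ → Fin m₁ → M} {b₂ : ℕ → Fin m₂ → M}
    (hb : AlternatingAverages L a₁ a₂ A b₁ b₂) {φ : ParamFormula L M (Fin m₁ ⊕ Fin m₂)}
    (hφ : φ.IsOver A) {n k : ℕ} (hnk : n ≤ k) :
    ∀ᶠ s in Filter.atTop, ∀ᶠ t in Filter.atTop,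
      (φ.Holds (Sum.elim (a₁ t) (a₂ s)) ↔ φ.Holds (Sum.elim (b₁ n) (b₂ k))) := by
  refine eventually_eventually_iff h₁ h₂ (B := A ∪ elems a₁ ∪ elems a₂) Set.subset_union_right
    ((hb n).1.average_mono fun c hc => Or.inl (Or.inl hc)) ((hb k).2.average_mono ?_)
    (hφ.mono fun c hc => Or.inl (Or.inl hc))
  rintro c (hc | ⟨i, rfl⟩)
  · exact Or.inl (Or.inl hc)
  · exact Or.inl (Or.inr ⟨n, hnk, i, rfl⟩)

/-- Along alternating realizations of the averages, `φ[b₁ n, b₂ k]` takes the other one of the two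
iterated eventual truth values if `k < n`. -/
theorem AlternatingAverages.eventually_iff_of_lt (h₁ : HasLimits L a₁) (h₂ : HasLimits L a₂)
    {A : Set M} {b₁ : ℕ → Fin m₁ → M} {b₂ : ℕ → Fin m₂ → M}
    (hb : AlternatingAverages L a₁ a₂ A b₁ b₂) {φ : ParamFormula L M (Fin m₁ ⊕ Fin m₂)}
    (hφ : φ.IsOver A) {n k : ℕ} (hkn : k < n) :
    ∀ᶠ t in Filter.atTop, ∀ᶠ s in Filter.atTop,
      (φ.Holds (Sum.elim (a₁ t) (a₂ s)) ↔ φ.Holds (Sum.elim (b₁ n) (b₂ k))) := by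
  have h := eventually_eventually_iff h₂ h₁ (B := A ∪ elems a₁ ∪ elems a₂) (b₁ := b₂ k)
    (b₂ := b₁ n) (φ := φ.swap) (fun c hc => Or.inl (Or.inr hc))
    ((hb k).2.average_mono fun c hc => Or.inl (Or.inl hc)) ((hb n).1.average_mono ?_)
    (hφ.mono fun c hc => Or.inl (Or.inl hc))
  · simpa only [ParamFormula.holds_swap] using h
  · rintro c (hc | ⟨i, rfl⟩)
    · exact Or.inl (Or.inl hc)
    · exact Or.inr ⟨k, hkn, i, rfl⟩

theorem eventualValuesAgree_of_iff {φ : ParamFormula L M (Fin m₁ ⊕ Fin m₂)} (P : Prop)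
    (hts : ∀ᶠ t in Filter.atTop, ∀ᶠ s in Filter.atTop, (φ.Holds (Sum.elim (a₁ t) (a₂ s)) ↔ P))
    (hst : ∀ᶠ s in Filter.atTop, ∀ᶠ t in Filter.atTop, (φ.Holds (Sum.elim (a₁ t) (a₂ s)) ↔ P)) :
    EventualValuesAgree a₁ a₂ φ := by
  classical
  exact ⟨decide P, by simpa using hts, by simpa using hst⟩

/-- The pair `(1, 0)` computes the limit with `t` outer, and the pair `(0, 0)` the limit with `s`
outer. -/
theorem AlternatingAverages.eventualValuesAgree (h₁ : HasLimits L a₁) (h₂ : HasLimits L a₂)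
    {A : Set M} {b₁ : ℕ → Fin m₁ → M} {b₂ : ℕ → Fin m₂ → M}
    (hb : AlternatingAverages L a₁ a₂ A b₁ b₂) {φ : ParamFormula L M (Fin m₁ ⊕ Fin m₂)}
    (hφ : φ.IsOver A)
    (h : φ.Holds (Sum.elim (b₁ 1) (b₂ 0)) ↔ φ.Holds (Sum.elim (b₁ 0) (b₂ 0))) :
    EventualValuesAgree a₁ a₂ φ :=
  eventualValuesAgree_of_iff _
    (by simpa only [h] using hb.eventually_iff_of_lt h₁ h₂ hφ Nat.zero_lt_one)
    (hb.eventually_iff_of_le h₁ h₂ hφ le_rfl)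

theorem eventually_eventually_unique {J₁ J₂ : Type*} {f₁ : Filter J₁} {f₂ : Filter J₂} [f₁.NeBot]
    [f₂.NeBot] {R : J₁ → J₂ → Prop} {P Q : Prop} (hP : ∀ᶠ t in f₁, ∀ᶠ s in f₂, (R t s ↔ P))
    (hQ : ∀ᶠ t in f₁, ∀ᶠ s in f₂, (R t s ↔ Q)) : P ↔ Q := by
  obtain ⟨t, ht, ht'⟩ := (hP.and hQ).exists
  obtain ⟨s, hs, hs'⟩ := (ht.and ht').exists
  exact hs.symm.trans hs'

/-- The two index tuples are moved one after the other, the tuples from the other sequence serving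
as parameters. -/
theorem MutuallyIndiscernibleOver.realize_iff {b₁ : ℕ → Fin m₁ → M} {b₂ : ℕ → Fin m₂ → M}
    (h : MutuallyIndiscernibleOver L b₁ b₂ ∅) {n : ℕ}
    (ψ : L.Formula (Fin n × (Fin m₁ ⊕ Fin m₂))) {i i' j j' : Fin n → ℕ} (hi : StrictMono i)
    (hi' : StrictMono i') (hj : StrictMono j) (hj' : StrictMono j') :
    ψ.Realize (fun z => Sum.elim (b₁ (i z.1)) (b₂ (j z.1)) z.2) ↔
      ψ.Realize (fun z => Sum.elim (b₁ (i' z.1)) (b₂ (j' z.1)) z.2) := by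
  have e₁ := h.1.realize_iff
    (ψ.relabel fun z => z.2.elim (fun l => Sum.inl (z.1, l)) fun l => Sum.inr (z.1, l))
    (fun z : Fin n × Fin m₂ => b₂ (j z.1) z.2) (fun z => Or.inl (mem_elems _ _ _)) hi hi'
  have e₂ := h.2.realize_iff
    (ψ.relabel fun z => z.2.elim (fun l => Sum.inr (z.1, l)) fun l => Sum.inl (z.1, l))
    (fun z : Fin n × Fin m₁ => b₁ (i' z.1) z.2) (fun z => Or.inl (mem_elems _ _ _)) hj hj'
  simp only [Language.Formula.realize_relabel] at e₁ e₂
  have t₁ : ∀ i j : Fin n → ℕ, (Sum.elim (fun z : Fin n × Fin m₁ => b₁ (i z.1) z.2)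
      (fun z : Fin n × Fin m₂ => b₂ (j z.1) z.2)) ∘ (fun z : Fin n × (Fin m₁ ⊕ Fin m₂) =>
        z.2.elim (fun l => Sum.inl (z.1, l)) fun l => Sum.inr (z.1, l)) =
      fun z => Sum.elim (b₁ (i z.1)) (b₂ (j z.1)) z.2 := by
    intro i j
    funext ⟨k, z⟩
    cases z <;> rfl
  have t₂ : ∀ i j : Fin n → ℕ, (Sum.elim (fun z : Fin n × Fin m₂ => b₂ (j z.1) z.2)
      (fun z : Fin n × Fin m₁ => b₁ (i z.1) z.2)) ∘ (fun z : Fin n × (Fin m₁ ⊕ Fin m₂) =>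
        z.2.elim (fun l => Sum.inr (z.1, l)) fun l => Sum.inl (z.1, l)) =
      fun z => Sum.elim (b₁ (i z.1)) (b₂ (j z.1)) z.2 := by
    intro i j
    funext ⟨k, z⟩
    cases z <;> rfl
  rw [t₁, t₁] at e₁
  rw [t₂, t₂] at e₂
  exact e₁.trans e₂

/-- In a structure without independent formulas, mutual indiscernibility over `∅` of alternating
realizations of the averages over `A` forces the iterated eventual truth values of the formulas
over `A` to agree. -/
theorem AlternatingAverages.eventualValuesAgree_of_mutuallyIndiscernible [Nonempty I₁] [Nonempty I₂]
    (hM : HasNIP L M)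
    (h₁ : HasLimits L a₁) (h₂ : HasLimits L a₂)
    {A : Set M} {b₁ : ℕ → Fin m₁ → M} {b₂ : ℕ → Fin m₂ → M}
    (hb : AlternatingAverages L a₁ a₂ A b₁ b₂) (hmut : MutuallyIndiscernibleOver L b₁ b₂ ∅)
    {φ : ParamFormula L M (Fin m₁ ⊕ Fin m₂)} (hφ : φ.IsOver A) :
    EventualValuesAgree a₁ a₂ φ := by
  classical
  refine hb.eventualValuesAgree h₁ h₂ hφ ?_
  by_contra hne
  have hle : ∀ {n k}, n ≤ k →
      (φ.Holds (Sum.elim (b₁ n) (b₂ k)) ↔ φ.Holds (Sum.elim (b₁ 0) (b₂ 0))) := fun hnk =>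
    eventually_eventually_unique (hb.eventually_iff_of_le h₁ h₂ hφ hnk)
      (hb.eventually_iff_of_le h₁ h₂ hφ le_rfl)
  have hlt : ∀ {n k}, k < n →
      (φ.Holds (Sum.elim (b₁ n) (b₂ k)) ↔ φ.Holds (Sum.elim (b₁ 1) (b₂ 0))) := fun hkn =>
    eventually_eventually_unique (hb.eventually_iff_of_lt h₁ h₂ hφ hkn)
      (hb.eventually_iff_of_lt h₁ h₂ hφ Nat.zero_lt_one)
  obtain ⟨n, hn⟩ := hM φ.arity (Fin m₁ ⊕ Fin m₂) (φ.formula.relabel Sum.swap)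
  obtain ⟨η, hη⟩ := hn fun z => Sum.elim (b₁ z.1) (b₂ z.1) z.2
  -- The `k`-th pair uses the indices `2k` and `2k + 1`: `d k = 0` puts the `b₁` index first, `d k =
  -- 1` the `b₂` index. As the two orders give opposite truth values, any pattern `η` arises, and
  -- mutual indiscernibility moves it to the pairs `(b₁ k, b₂ k)`.
  let d : Fin n → ℕ := fun k =>
    if (η k = true ↔ φ.Holds (Sum.elim (b₁ 0) (b₂ 0))) then 0 else 1
  have hd : ∀ k, d k ≤ 1 := fun k => by
    simp only [d]
    split_ifs <;> omega
  refine hη ((hmut.realize_iff _ (i := fun k => 2 * k + d k) (j := fun k => 2 * k + (1 - d k))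
    ?_ (fun _ _ h => h) ?_ (fun _ _ h => h)).1 ?_)
  · intro k l hkl
    have := hd k
    have : (k : ℕ) < l := hkl
    dsimp only
    omega
  · intro k l hkl
    have : (k : ℕ) < l := hkl
    dsimp only
    omega
  · rw [realize_patternFormula]
    refine ⟨φ.params, fun k => ?_⟩
    have hswap : ∀ y : Fin m₁ ⊕ Fin m₂ → M,
        (φ.formula.relabel Sum.swap).Realize (Sum.elim φ.params y) ↔ φ.Holds y := by
      intro y
      rw [Language.Formula.realize_relabel]
      refine iff_of_eq (congrArg _ (funext fun z => ?_))
      cases z <;> rfl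
    rw [hswap]
    change φ.Holds (Sum.elim (b₁ (2 * k + d k)) (b₂ (2 * k + (1 - d k)))) ↔ _
    by_cases hk : (η k = true ↔ φ.Holds (Sum.elim (b₁ 0) (b₂ 0)))
    · have hdk : d k = 0 := if_pos hk
      rw [hk]
      exact hle (by omega)
    · have hdk : d k = 1 := if_neg hk
      rw [hlt (by omega)]
      tauto

/-! ### Saturated elementary submodels -/

/-- The structure `F` realizes the type, over a small subset of `F`, of every finite tuple of the
ambient structure. -/
theorem IsSaturated.exists_realize_iff {F : L.ElementarySubstructure M} {μ : Cardinal.{w}}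
    (hF : IsSaturated L F μ) {A : Set F} (hA : #A < μ) {n : ℕ} (c : Fin n → M) :
    ∃ d : Fin n → F, ∀ θ : ParamFormula L F (Fin n), θ.IsOver A →
      (θ.Holds d ↔ θ.formula.Realize (Sum.elim c fun i => (θ.params i : M))) := by
  obtain ⟨d, hd⟩ := hF A hA n
    {θ | θ.IsOver A ∧ θ.formula.Realize (Sum.elim c fun i => (θ.params i : M))}
    (fun θ hθ => hθ.1) (by
      intro q hq hfin
      have := hfin.to_subtype
      -- A finite part of the type is a single conjunction over `F`; `c` satisfies it in `M`, so by
      -- elementarity some tuple of `F` does.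
      let ψ : L.Formula ((Σ θ : q, Fin θ.1.arity) ⊕ Fin n) :=
        Language.Formula.iInf fun θ : q =>
          θ.1.formula.relabel (Sum.elim Sum.inr fun i => Sum.inl ⟨θ, i⟩)
      let p : (Σ θ : q, Fin θ.1.arity) → F := fun z => z.1.1.params z.2
      have hM : (ψ.iExs (Fin n)).Realize (F.subtype ∘ p) := by
        rw [Language.Formula.realize_iExs]
        refine ⟨c, Language.Formula.realize_iInf.2 fun θ => ?_⟩
        rw [Language.Formula.realize_relabel]
        convert (hq θ.2).2 using 1
        funext z
        cases z <;> rfl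
      rw [F.subtype.map_formula, Language.Formula.realize_iExs] at hM
      obtain ⟨x, hx⟩ := hM
      refine ⟨x, fun θ hθ => ?_⟩
      have h := Language.Formula.realize_iInf.1 hx ⟨θ, hθ⟩
      rw [Language.Formula.realize_relabel] at h
      unfold ParamFormula.Holds
      convert h using 1
      funext z
      cases z <;> rfl)
  refine ⟨d, fun θ hθ => ⟨fun h => ?_, fun h => hd θ ⟨hθ, h⟩⟩⟩
  by_contra hcon
  exact (θ.holds_not d).1 (hd θ.not ⟨hθ, by simpa [ParamFormula.not] using hcon⟩) h

theorem IsSaturated.top {κ μ : Cardinal.{w}} (hM : IsSaturated L M κ) (hμ : μ ≤ κ) :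
    IsSaturated L (⊤ : L.ElementarySubstructure M) μ := by
  let F : L.ElementarySubstructure M := ⊤
  have key : ∀ {n : ℕ} (θ : ParamFormula L F (Fin n)) (x : Fin n → F),
      (⟨θ.arity, θ.formula, fun i => (θ.params i : M)⟩ : ParamFormula L M (Fin n)).Holds
        (fun i => (x i : M)) ↔ θ.Holds x := by
    intro n θ x
    unfold ParamFormula.Holds
    rw [← F.subtype.map_formula θ.formula]
    refine iff_of_eq (congrArg _ (funext fun z => ?_))
    cases z <;> rfl
  intro A hA n p hp hfin
  let f : ParamFormula L F (Fin n) → ParamFormula L M (Fin n) :=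
    fun θ => ⟨θ.arity, θ.formula, fun i => (θ.params i : M)⟩
  obtain ⟨x, hx⟩ := hM (Subtype.val '' A) (mk_image_le.trans_lt (hA.trans_le hμ)) n (f '' p) (by
      rintro _ ⟨θ, hθ, rfl⟩ i
      exact ⟨_, hp θ hθ i, rfl⟩) (by
      intro q hq hqfin
      obtain ⟨q', hq', hq'fin, rfl⟩ := Set.exists_subset_image_finite_and.1 ⟨q, hq, hqfin, rfl⟩
      obtain ⟨x, hx⟩ := hfin q' hq' hq'fin
      refine ⟨fun i => x i, ?_⟩
      rintro _ ⟨θ, hθ, rfl⟩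
      exact (key θ x).2 (hx θ hθ))
  refine ⟨fun i => ⟨x i, Language.ElementarySubstructure.mem_top _⟩, fun θ hθ => ?_⟩
  exact (key θ _).1 (hx _ ⟨θ, hθ, rfl⟩)

/-- Agreement of the iterated eventual truth values for formulas over a sufficiently saturated
elementary submodel containing both sequences implies agreement for all formulas. -/
theorem eventualValuesAgree_of_elementarySubstructure {F : L.ElementarySubstructure M}
    {μ : Cardinal.{w}} (hF : IsSaturated L F μ) (hF₁ : elems a₁ ⊆ F) (hF₂ : elems a₂ ⊆ F)
    (hμ : #(elems a₁ ∪ elems a₂ : Set M) < μ)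
    (h : ∀ φ : ParamFormula L M (Fin m₁ ⊕ Fin m₂), φ.IsOver (F : Set M) →
      EventualValuesAgree a₁ a₂ φ)
    (φ : ParamFormula L M (Fin m₁ ⊕ Fin m₂)) : EventualValuesAgree a₁ a₂ φ := by
  obtain ⟨d, hd⟩ := hF.exists_realize_iff (A := Subtype.val ⁻¹' (elems a₁ ∪ elems a₂))
    ((mk_preimage_of_injective _ _ Subtype.val_injective).trans_lt hμ) φ.params
  have key : ∀ t s, (⟨φ.arity, φ.formula, fun i => (d i : M)⟩ :
      ParamFormula L M (Fin m₁ ⊕ Fin m₂)).Holds (Sum.elim (a₁ t) (a₂ s)) ↔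
      φ.Holds (Sum.elim (a₁ t) (a₂ s)) := by
    intro t s
    let g : Fin m₁ ⊕ Fin m₂ → F := Sum.elim (fun i => ⟨a₁ t i, hF₁ (mem_elems a₁ t i)⟩)
      fun i => ⟨a₂ s i, hF₂ (mem_elems a₂ s i)⟩
    have hg : ∀ z, (g z : M) = Sum.elim (a₁ t) (a₂ s) z := by
      intro z
      cases z <;> rfl
    -- Variables and parameters change places: `d` fills the variables, while `a₁ t` and `a₂ s`
    -- become parameters.
    have hθ := hd ⟨m₁ + m₂,
      φ.formula.relabel (Sum.elim (fun z => Sum.inr (finSumFinEquiv z)) Sum.inl),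
      fun i => g (finSumFinEquiv.symm i)⟩ (by
        intro i
        change (g (finSumFinEquiv.symm i) : M) ∈ elems a₁ ∪ elems a₂
        rw [hg]
        cases finSumFinEquiv.symm i with
        | inl z => exact Or.inl (mem_elems a₁ t z)
        | inr z => exact Or.inr (mem_elems a₂ s z))
    unfold ParamFormula.Holds at hθ ⊢
    rw [← F.subtype.map_formula] at hθ
    simp only [Language.Formula.realize_relabel] at hθ
    convert hθ using 2
    · funext z
      rcases z with z | z <;> simp [hg]
    · funext z
      rcases z with z | z <;> simp [hg]
  have := h ⟨φ.arity, φ.formula, fun i => (d i : M)⟩ fun i => (d i).2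
  simpa only [EventualValuesAgree, key] using this

end

end Dependent

/-! ### The equivalences, each through (4) -/

theorem claim2 {L : FirstOrder.Language.{u, v}} (T : L.Theory) (hT : T.IsComplete)
    (hdep : Dependent.IsDependent T)
    -- the monster model: a `κ`-saturated model of `T`
    (C : Type w) [L.Structure C] [C ⊨ T] (κ : Cardinal.{w}) (hC : Dependent.IsSaturated L C κ)
    -- two endless indiscernible sequences of length less than `κ`
    (I₁ I₂ : Type w) [LinearOrder I₁] [Nonempty I₁] [NoMaxOrder I₁]
    [LinearOrder I₂] [Nonempty I₂] [NoMaxOrder I₂] (hI₁ : #I₁ < κ) (hI₂ : #I₂ < κ)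
    (m₁ m₂ : ℕ) (a₁ : I₁ → Fin m₁ → C) (a₂ : I₂ → Fin m₂ → C)
    (ha₁ : Dependent.IndiscernibleOver L a₁ ∅) (ha₂ : Dependent.IndiscernibleOver L a₂ ∅) :
    List.TFAE [
      -- (1)
      Dependent.Perpendicular L κ a₁ a₂,
      -- (2)
      ∀ (b₁ : ℕ → Fin m₁ → C) (b₂ : ℕ → Fin m₂ → C),
        Dependent.AlternatingAverages L a₁ a₂ ∅ b₁ b₂ →
          Dependent.MutuallyIndiscernibleOver L b₁ b₂ ∅,
      -- (3)
      ∀ A : Set C, #A < κ → ∀ (b₁ : Fin m₁ → C) (b₂ : Fin m₂ → C),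
        Dependent.Realizes b₁
          (Dependent.average L (Dependent.elems a₁ ∪ Dependent.elems a₂ ∪ A) a₁) →
        Dependent.Realizes b₂
          (Dependent.average L
            (Dependent.elems a₁ ∪ Dependent.elems a₂ ∪ A ∪ Set.range b₁) a₂) →
        Dependent.Realizes b₁
          (Dependent.average L
            (Dependent.elems a₁ ∪ Dependent.elems a₂ ∪ A ∪ Set.range b₂) a₁),
      -- (4)
      ∀ φ : Dependent.ParamFormula L C (Fin m₁ ⊕ Fin m₂), Dependent.EventualValuesAgree a₁ a₂ φ,
      -- (5)
      ∃ F : L.ElementarySubstructure C,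
        Dependent.IsSaturated L F (Order.succ (#I₁ + #I₂)) ∧
        Dependent.elems a₁ ⊆ F ∧ Dependent.elems a₂ ⊆ F ∧
        ∀ φ : Dependent.ParamFormula L C (Fin m₁ ⊕ Fin m₂), φ.IsOver (F : Set C) →
          Dependent.EventualValuesAgree a₁ a₂ φ] := by
  have : Infinite I₁ := NoMaxOrder.infinite
  have : Infinite I₂ := NoMaxOrder.infinite
  have hκ : ℵ₀ ≤ κ := (aleph0_le_mk I₁).trans hI₁.le
  have he₁ : #(Dependent.elems a₁) < κ := (Dependent.mk_elems_le a₁).trans_lt hI₁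
  have he₂ : #(Dependent.elems a₂) < κ := (Dependent.mk_elems_le a₂).trans_lt hI₂
  have hlim : Dependent.HasLimits L a₁ ∧ Dependent.HasLimits L a₂ := by
    -- The transfer of NIP from `T` needs a nonempty model; in an empty one all tuples of a given
    -- length coincide.
    rcases isEmpty_or_nonempty C with hE | hN
    · constructor
      · intro φ
        by_cases h : φ.Holds (a₁ (Classical.arbitrary I₁))
        · exact Or.inl (Filter.Eventually.of_forall fun t => by
            rwa [Subsingleton.elim (a₁ t)])
        · exact Or.inr (Filter.Eventually.of_forall fun t => by
            rwa [Subsingleton.elim (a₁ t)])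
      · intro φ
        by_cases h : φ.Holds (a₂ (Classical.arbitrary I₂))
        · exact Or.inl (Filter.Eventually.of_forall fun t => by
            rwa [Subsingleton.elim (a₂ t)])
        · exact Or.inr (Filter.Eventually.of_forall fun t => by
            rwa [Subsingleton.elim (a₂ t)])
    · exact ⟨(hdep.hasNIP hT).hasLimits ha₁, (hdep.hasNIP hT).hasLimits ha₂⟩
  obtain ⟨h₁, h₂⟩ := hlim
  have hpar : ∀ φ : Dependent.ParamFormula L C (Fin m₁ ⊕ Fin m₂), φ.IsOver (Set.range φ.params) :=
    fun φ i => Set.mem_range_self i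
  tfae_have 4 → 1 := by
    intro h4 A hA
    obtain ⟨b₁, b₂, hb⟩ := hC.exists_alternatingAverages hκ hA he₁ he₂
    exact ⟨b₁, b₂, hb, hb.mutuallyIndiscernibleOver h₁ h₂ h4⟩
  tfae_have 1 → 4 := by
    intro h1 φ
    -- With the parameters of `φ` in `A`, indiscernibility of `b₁` over them and `b₂` makes `b₁ 0`
    -- and `b₁ 1` agree on `φ` at `b₂ 0`.
    obtain ⟨b₁, b₂, hb, hmut⟩ := h1 _ (Dependent.mk_range_fin_lt hκ φ.params)
    refine hb.eventualValuesAgree h₁ h₂ (hpar φ) ?_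
    obtain ⟨θ, hθ, h⟩ := φ.exists_substRight
      (A := Dependent.elems b₂ ∪ (Set.range φ.params ∪ Dependent.elems a₁ ∪ Dependent.elems a₂))
      ((hpar φ).mono fun c hc => Or.inr (Or.inl (Or.inl hc))) (b₂ 0)
      fun i => Or.inl (Dependent.mem_elems b₂ 0 i)
    obtain ⟨θ', hθ', h'⟩ := θ.exists_specialize (α := Fin 1 × Fin m₁) hθ
      (fun i => Sum.inl (0, i)) (by simp)
    have := hmut.1 1 θ' hθ' (fun _ => 1) (fun _ => 0) (Subsingleton.strictMono _)
      (Subsingleton.strictMono _)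
    rw [h', h'] at this
    rw [← h, ← h]
    exact this
  tfae_have 4 → 2 := by
    intro h4 b₁ b₂ hb
    obtain ⟨hm₁, hm₂⟩ := hb.mutuallyIndiscernibleOver h₁ h₂ h4
    exact ⟨fun n φ hφ => hm₁ n φ (hφ.mono (by gcongr; simp)),
      fun n φ hφ => hm₂ n φ (hφ.mono (by gcongr; simp))⟩
  tfae_have 2 → 4 := by
    intro h2 φ
    obtain ⟨b₁, b₂, hb⟩ :=
      hC.exists_alternatingAverages hκ (Dependent.mk_range_fin_lt hκ φ.params) he₁ he₂
    rcases isEmpty_or_nonempty C with hE | hN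
    · exact hb.eventualValuesAgree h₁ h₂ (hpar φ) (by rw [Subsingleton.elim (b₁ 1) (b₁ 0)])
    · exact hb.eventualValuesAgree_of_mutuallyIndiscernible (hdep.hasNIP hT) h₁ h₂
        -- The tuples are chosen over the parameters of `φ`, but (2) needs averages over the two
        -- sequences only.
        (h2 b₁ b₂ (hb.mono (Set.empty_subset _))) (hpar φ)
  tfae_have 4 → 3 := by
    intro h4 A _ b₁ b₂ hb₁ hb₂
    exact Dependent.Realizes.exchange h₁ h₂ h4 (fun c hc => Or.inl (Or.inl hc))
      (fun c hc => Or.inl (Or.inr hc)) hb₁ hb₂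
  tfae_have 3 → 4 := by
    intro h3 φ
    set B := Dependent.elems a₁ ∪ Dependent.elems a₂ ∪ Set.range φ.params with hB
    have hBκ : #B < κ :=
      Dependent.mk_union_lt hκ (Dependent.mk_union_lt hκ he₁ he₂) (Dependent.mk_range_fin_lt hκ φ.params)
    obtain ⟨b₁, hb₁⟩ := hC.exists_realizes a₁ hBκ
    obtain ⟨b₂, hb₂⟩ := hC.exists_realizes a₂
      (Dependent.mk_union_lt hκ hBκ (Dependent.mk_range_fin_lt hκ b₁))
    have hb₁' := h3 _ (Dependent.mk_range_fin_lt hκ φ.params) b₁ b₂ hb₁ hb₂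
    have hφ : φ.IsOver B := (hpar φ).mono Set.subset_union_right
    -- By (3) the pair counts as chosen in either order, so both limits equal `φ[b₁, b₂]`.
    have hst := Dependent.eventually_eventually_iff h₁ h₂ (fun c hc => Or.inl (Or.inr hc)) hb₁ hb₂ hφ
    have hts := Dependent.eventually_eventually_iff h₂ h₁ (φ := φ.swap) (B := B)
      (fun c hc => Or.inl (Or.inl hc)) (hb₂.average_mono Set.subset_union_left) hb₁' hφ
    simp only [Dependent.ParamFormula.holds_swap] at hts
    exact Dependent.eventualValuesAgree_of_iff _ hts hst
  tfae_have 4 → 5 := by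
    intro h4
    refine ⟨⊤, hC.top (Order.succ_le_of_lt (add_lt_of_lt hκ hI₁ hI₂)), fun c _ => trivial,
      fun c _ => trivial, fun φ _ => h4 φ⟩
  tfae_have 5 → 4 := by
    rintro ⟨F, hF, hF₁, hF₂, h⟩
    refine Dependent.eventualValuesAgree_of_elementarySubstructure hF hF₁ hF₂ ?_ h
    exact Order.lt_succ_of_le ((mk_union_le _ _).trans
      (add_le_add (Dependent.mk_elems_le a₁) (Dependent.mk_elems_le a₂)))
  tfae_finish
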